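/- **Setting.** Let $|k,l\rangle$, $k,l\ge 0$, be the Fock basis of two optical modes and $\hat P_n$ the projector onto total photon number $n$. Let $\mu>0$, $\tau\in\mathbb R$, $\mathbf{R_0}=\{(q_1,q_2)\in\mathbb R^2:|q_1|<\tau,\ |q_2|>\tau\}$, and let $\mathcal N_E$ be an arbitrary quantum channel (a linear, completely positive, trace-preserving map on the trace-class operators of the two modes). Let $$\psi_n(q)=\frac{1}{\sqrt{2^n n!\sqrt{2\pi}}}H_n(q/\sqrt2)\,e^{-q^2/4},\qquad |q(\varphi)\rangle=\sum_n\psi_n(q)e^{in\varphi}|n\rangle ,$$ where $H_n$ are the physicists' Hermite polynomials; $|q(\varphi)\rangle$ is the generalized eigenvector of the quadrature $\hat a e^{-i\varphi}+\hat a^\dagger e^{i\varphi}$. Integrals of operators built from such vectors are understood through their Fock matrix elements. The source prepares the phase-randomized state $\hat\rho_{A'A_1A_2}=\int_0^{2\pi}\frac{d\varphi}{2\pi}|\Psi_\varphi\rangle\langle\Psi_\varphi|$ with $|\Psi_\varphi\rangle=\frac1{\sqrt2}\big(|0\rangle_{A'}|0\rangle|\sqrt\mu e^{i\varphi}\rangle+|1\rangle_{A'}|\sqrt\mu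 e^{i\varphi}\rangle|0\rangle\big)$, where $|\sqrt\mu e^{i\varphi}\rangle$ is a coherent state; it emits $m$ photons with probability $\Pr(m)=e^{-\mu}\mu^m/m!$. The squashing map from the two modes to a qubit $B'$ is $$\mathcal F(\hat\rho)=\int_0^{2\pi}\frac{d\varphi}{2\pi}\int_{\mathbf{R_0}}dq_1dq_2\,\hat K\hat\rho\hat K^\dagger,\qquad \hat K=|0\rangle\langle q_1(\varphi),q_2(\varphi)|+|1\rangle\langle q_2(\varphi),q_1(\varphi)|.$$ The gain $Q_{m,n}$ (the probability that $m$ photons are sent and $n$ are accepted) is the trace of $\mathcal F\{\hat P_n\,\mathcal N_E[\hat P_m\hat\rho_{A'A_1A_2}\hat P_m]\,\hat P_n\}=Q_{m,n}\hat\rho^{(m,n)}_{A'B'}$, the maps acting trivially on $A'$, and the phase-error rate is $e^X_{m,n}=\mathrm{Tr}[\hat\rho^{(m,n)}_{A'B'}(|{+-}\rangle\langle{+-}|+|{-+}\rangle\langle{-+}|)]$, with $|\pm\rangle=(|0\rangle\pm|1\rangle)/\sqrt2$ (so $Q_{m,n}e^X_{m,n}=0$ if $Q_{m,n}=0$). Let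 $|\Psi_m\rangle=\frac1{\sqrt2}(|0\rangle_{A'}|0m\rangle+|1\rangle_{A'}|m0\rangle)$, $|\Psi_m^\pm\rangle=\frac1{\sqrt2}(|0m\rangle\pm|m0\rangle)$, $\hat\rho_m=\mathrm{Tr}_{A'}|\Psi_m\rangle\langle\Psi_m|$, and $$\hat M_\pm=\frac12\int_{\mathbf{R_0}}dq_1dq_2\int_0^{2\pi}\frac{d\varphi}{2\pi}\big[|q_1(\varphi),q_2(\varphi)\rangle\pm|q_2(\varphi),q_1(\varphi)\rangle\big]\big[\langle q_1(\varphi),q_2(\varphi)|\pm\langle q_2(\varphi),q_1(\varphi)|\big].$$ **Proposition.** For all $m,n\ge0$, $$\frac{Q_{m,n}e^X_{m,n}}{\Pr(m)}=\frac12\mathrm{Tr}\big[\mathcal N_E(|\Psi_m^+\rangle\langle\Psi_m^+|)\hat P_n\hat M_-\hat P_n+\mathcal N_E(|\Psi_m^-\rangle\langle\Psi_m^-|)\hat P_n\hat M_+\hat P_n\big].$$ In particular, write $|\chi_n^\pm\rangle=\frac1{\sqrt2}(|0n\rangle\pm|n0\rangle)$ for the same vectors on the receiver's modes. For $m=n=1$,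 $$\frac{Q_{1,1}e^X_{1,1}}{\Pr(1)}=\frac{c_1}2\Big\{\mathrm{Tr}\big[\mathcal N_E(|\Psi_1^+\rangle\langle\Psi_1^+|)|\chi_1^-\rangle\langle\chi_1^-|\big]+\mathrm{Tr}\big[\mathcal N_E(|\Psi_1^-\rangle\langle\Psi_1^-|)|\chi_1^+\rangle\langle\chi_1^+|\big]\Big\},$$ $$\frac{Q_{1,1}}{\Pr(1)}=c_1\mathrm{Tr}\big\{\mathcal N_E(\hat\rho_1)(|01\rangle\langle01|+|10\rangle\langle10|)\big\},\qquad c_1=\int_{\mathbf{R_0}}\big[\psi_0^2(q_1)\psi_1^2(q_2)+\psi_0^2(q_2)\psi_1^2(q_1)\big]dq_1dq_2 .$$ For $m=n=2$, $$\frac{Q_{2,2}e^X_{2,2}}{\Pr(2)}=\tfrac12(c_2^{02}-d_2)\mathrm{Tr}\big[\mathcal N_E(|\Psi_2^+\rangle\langle\Psi_2^+|)|\chi_2^-\rangle\langle\chi_2^-|\big]+\tfrac12(c_2^{02}+d_2)\mathrm{Tr}\big[\mathcal N_E(|\Psi_2^-\rangle\langle\Psi_2^-|)|\chi_2^+\rangle\langle\chi_2^+|\big]+\tfrac12c_2^{11}\mathrm{Tr}\big[\mathcal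 N_E(|\Psi_2^-\rangle\langle\Psi_2^-|)|11\rangle\langle11|\big],$$ $$\frac{Q_{2,2}}{\Pr(2)}=c_2^{02}\mathrm{Tr}\{\mathcal N_E(\hat\rho_2)(|02\rangle\langle02|+|20\rangle\langle20|)\}+c_2^{11}\mathrm{Tr}\{\mathcal N_E(\hat\rho_2)|11\rangle\langle11|\}+d_2\mathrm{Tr}\{\mathcal N_E(\hat\rho_2)(|02\rangle\langle20|+|20\rangle\langle02|)\},$$ with $c_2^{02}=\int_{\mathbf{R_0}}[\psi_0^2(q_1)\psi_2^2(q_2)+\psi_2^2(q_1)\psi_0^2(q_2)]dq_1dq_2$, $c_2^{11}=\int_{\mathbf{R_0}}2\psi_1^2(q_1)\psi_1^2(q_2)dq_1dq_2$ and $d_2=\int_{\mathbf{R_0}}2\psi_0(q_1)\psi_2(q_1)\psi_0(q_2)\psi_2(q_2)dq_1dq_2$. -/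

import Mathlib

namespace TimeBinCV

open InnerProductSpace MeasureTheory
open scoped ComplexOrder

noncomputable section

/-! ### Two optical modes in the Fock representation -/

/-- The Hilbert space of two optical modes, with orthonormal Fock basis `|k, l⟩`,
`(k, l) : ℕ × ℕ`. -/
abbrev TwoMode : Type := lp (fun _ : ℕ × ℕ => ℂ) 2

/-- Bounded operators on the two modes. -/
abbrev Op : Type := TwoMode →L[ℂ] TwoMode

/-- The Fock state `|k, l⟩`. -/
def fock (k l : ℕ) : TwoMode := lp.single 2 (k, l) (1 : ℂ)

/-- The operator `|x⟩⟨y|`. -/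
def ketBra (x y : TwoMode) : Op := rankOne ℂ x y

/-- The Fock matrix element `⟨a| T |b⟩`. -/
def fockEntry (T : Op) (a b : ℕ × ℕ) : ℂ :=
  inner ℂ (fock a.1 a.2) (T (fock b.1 b.2))

/-- The trace, computed in the Fock basis. -/
def opTrace (T : Op) : ℂ := ∑' a : ℕ × ℕ, fockEntry T a a

/-- The absolute value `|T| = √(T† T)` of a bounded operator on a Hilbert space. -/
def absOp {H : Type*} [NormedAddCommGroup H] [InnerProductSpace ℂ H] [CompleteSpace H]
    (T : H →L[ℂ] H) : H →L[ℂ] H := CFC.abs T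

/-- `T` is trace class: `Tr |T| < ∞`. -/
def IsTraceClass (T : Op) : Prop :=
  Summable fun a : ℕ × ℕ => (fockEntry (absOp T) a a).re

/-- The projector `P_n` onto total photon number `n`. -/
def photonProj (n : ℕ) : Op :=
  ∑ a ∈ Finset.HasAntidiagonal.antidiagonal n, ketBra (fock a.1 a.2) (fock a.1 a.2)

/-- `P_n A P_n = ∑_{a, b} |a⟩⟨a| A |b⟩⟨b|` (over Fock labels `a`, `b` of total photon number `n`)
for an operator `A` that is given, in the weak sense, by its Fock matrix elements. -/
def photonBlock (n : ℕ) (A : Matrix (ℕ × ℕ) (ℕ × ℕ) ℂ) : Op :=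
  ∑ a ∈ Finset.HasAntidiagonal.antidiagonal n, ∑ b ∈ Finset.HasAntidiagonal.antidiagonal n,
    A a b • ketBra (fock a.1 a.2) (fock b.1 b.2)

/-! ### Quantum channels -/

/-- A matrix of operators is positive as an operator on `ℂ^k ⊗ TwoMode`. -/
def BlockPositive {k : ℕ} (ρ : Fin k → Fin k → Op) : Prop :=
  ∀ v : Fin k → TwoMode, 0 ≤ ∑ i, ∑ j, inner ℂ (v i) (ρ i j (v j))

/-- `N` is a quantum channel: on the trace-class operators it is linear, completely positive and
trace preserving.  (Its values on the other bounded operators carry no meaning; any linear map on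
the trace-class operators extends linearly to all of `Op`.) -/
structure IsChannel (N : Op →ₗ[ℂ] Op) : Prop where
  traceClass : ∀ ρ, IsTraceClass ρ → IsTraceClass (N ρ)
  trace_eq : ∀ ρ, IsTraceClass ρ → opTrace (N ρ) = opTrace ρ
  completelyPositive : ∀ (k : ℕ) (ρ : Fin k → Fin k → Op),
    (∀ i j, IsTraceClass (ρ i j)) → BlockPositive ρ → BlockPositive fun i j => N (ρ i j)

/-! ### The source -/

/-- Fock amplitude `⟨n|α⟩` of the coherent state `|α⟩`. -/
def coherentAmp (α : ℂ) (n : ℕ) : ℂ :=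
  (Real.exp (-‖α‖ ^ 2 / 2) : ℂ) * α ^ n / (Real.sqrt (n.factorial) : ℂ)

/-- Amplitude `⟨i|⟨a|` on `A' A₁ A₂` of
`(|0⟩ |0⟩|√μ e^{iφ}⟩ + |1⟩ |√μ e^{iφ}⟩|0⟩) / √2`. -/
def sourceAmp (μ φ : ℝ) (i : Fin 2) (a : ℕ × ℕ) : ℂ :=
  let α : ℂ := (Real.sqrt μ : ℂ) * Complex.exp (Complex.I * φ)
  (1 / Real.sqrt 2 : ℂ) *
    if i = 0 then coherentAmp 0 a.1 * coherentAmp α a.2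
    else coherentAmp α a.1 * coherentAmp 0 a.2

/-- Fock matrix of the block `⟨i| ρ |j⟩` (`i, j` labels of `A'`) of the phase-randomized
entangled source state. -/
def source (μ : ℝ) (i j : Fin 2) : Matrix (ℕ × ℕ) (ℕ × ℕ) ℂ := fun a b =>
  ∫ φ in (0 : ℝ)..(2 * Real.pi),
    (1 / (2 * Real.pi) : ℂ) * (sourceAmp μ φ i a * star (sourceAmp μ φ j b))

/-- The Poisson probability that the source emits `m` photons. -/
def prPhoton (μ : ℝ) (m : ℕ) : ℝ := Real.exp (-μ) * μ ^ m / m.factorial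

/-- `|Ψ_m⟩ = (|0⟩|0m⟩ + |1⟩|m0⟩)/√2`, as its two components along `A'`. -/
def psi (m : ℕ) (i : Fin 2) : TwoMode :=
  (1 / Real.sqrt 2 : ℂ) • if i = 0 then fock 0 m else fock m 0

/-- `|Ψ_m^s⟩ = (|0m⟩ + s |m0⟩)/√2`, used for `s = ±1`. -/
def psiPM (m : ℕ) (s : ℝ) : TwoMode :=
  (1 / Real.sqrt 2 : ℂ) • (fock 0 m + (s : ℂ) • fock m 0)

/-- `Tr_{A'} |Ψ_m⟩⟨Ψ_m|`. -/
def reducedPsi (m : ℕ) : Op := ∑ i : Fin 2, ketBra (psi m i) (psi m i)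

/-! ### Homodyne detection -/

/-- The physicists' Hermite polynomial `H_n`; Mathlib's `hermite` is the probabilists' one. -/
def physHermite (n : ℕ) (x : ℝ) : ℝ :=
  Real.sqrt 2 ^ n * Polynomial.aeval (Real.sqrt 2 * x) (Polynomial.hermite n)

/-- The coordinate representation `ψ_n` of the Fock state `|n⟩`. -/
def hermiteFun (n : ℕ) (q : ℝ) : ℝ :=
  1 / Real.sqrt (2 ^ n * n.factorial * Real.sqrt (2 * Real.pi)) *
    physHermite n (q / Real.sqrt 2) * Real.exp (-q ^ 2 / 4)

/-- Fock coefficient `⟨n|q(φ)⟩ = ψ_n(q) e^{inφ}` of the generalized eigenvector `|q(φ)⟩`, with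
eigenvalue `q`, of the quadrature `a e^{-iφ} + a† e^{iφ}`. -/
def quadKet (q φ : ℝ) (n : ℕ) : ℂ :=
  (hermiteFun n q : ℂ) * Complex.exp (Complex.I * n * φ)

/-- Fock coefficient `⟨a|q₁(φ), q₂(φ)⟩`. -/
def quadKet₂ (q₁ q₂ φ : ℝ) (a : ℕ × ℕ) : ℂ := quadKet q₁ φ a.1 * quadKet q₂ φ a.2

/-- The region `R₀` of quadratures decoded as the key bit `0`. -/
def regionZero (τ : ℝ) : Set (ℝ × ℝ) := {q | |q.1| < τ ∧ τ < |q.2|}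

/-- The operator `K^{(q₁,q₂,φ)} = |0⟩⟨q₁(φ),q₂(φ)| + |1⟩⟨q₂(φ),q₁(φ)|` from the two modes to the
qubit `B'`: its matrix elements `⟨k| K |a⟩`. -/
def krausAmp (q₁ q₂ φ : ℝ) (k : Fin 2) (a : ℕ × ℕ) : ℂ :=
  star (if k = 0 then quadKet₂ q₁ q₂ φ a else quadKet₂ q₂ q₁ φ a)

/-- The squashing map `ρ ↦ ∫ dφ/2π ∫_{R₀} dq₁ dq₂ K ρ K†`, as a matrix on the qubit `B'`.  It is
applied below to operators in a fixed photon-number space, where the sums are finite. -/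
def squash (τ : ℝ) (ρ : Op) : Matrix (Fin 2) (Fin 2) ℂ := fun k l =>
  ∫ φ in (0 : ℝ)..(2 * Real.pi), (1 / (2 * Real.pi) : ℂ) *
    ∫ q in regionZero τ, ∑' a : ℕ × ℕ, ∑' b : ℕ × ℕ,
      krausAmp q.1 q.2 φ k a * fockEntry ρ a b * star (krausAmp q.1 q.2 φ l b)

/-- Fock matrix of
`M_s = ½ ∫_{R₀} dq₁ dq₂ ∫ dφ/2π [|q₁,q₂⟩ + s|q₂,q₁⟩][⟨q₁,q₂| + s⟨q₂,q₁|]`, used for `s = ±1`. -/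
def compOp (τ s : ℝ) : Matrix (ℕ × ℕ) (ℕ × ℕ) ℂ := fun a b =>
  (1 / 2 : ℂ) * ∫ q in regionZero τ, ∫ φ in (0 : ℝ)..(2 * Real.pi), (1 / (2 * Real.pi) : ℂ) *
    ((quadKet₂ q.1 q.2 φ a + s * quadKet₂ q.2 q.1 φ a) *
      star (quadKet₂ q.1 q.2 φ b + s * quadKet₂ q.2 q.1 φ b))

/-! ### Gains and phase-error rates -/

/-- The unnormalized state on `A' B'` of the rounds where `m` photons are sent and `n` are
accepted: the source is projected onto `m` photons, sent through Eve's channel `N` (identity on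
`A'`), projected onto `n` photons and squashed. -/
def taggedState (μ τ : ℝ) (N : Op →ₗ[ℂ] Op) (m n : ℕ) :
    Matrix (Fin 2 × Fin 2) (Fin 2 × Fin 2) ℂ := fun x y =>
  squash τ (photonProj n ∘L N (photonBlock m (source μ x.1 y.1)) ∘L photonProj n) x.2 y.2

/-- The gain `Q_{m,n}`: the probability of sending `m` and accepting `n` photons. -/
def gain (μ τ : ℝ) (N : Op →ₗ[ℂ] Op) (m n : ℕ) : ℝ := (taggedState μ τ N m n).trace.re

/-- `|s⟩ = (|0⟩ + s|1⟩)/√2`, used for `s = ±1`. -/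
def xKet (s : ℝ) (i : Fin 2) : ℂ := (1 / Real.sqrt 2 : ℂ) * if i = 0 then 1 else (s : ℂ)

/-- The projector onto `|s⟩|t⟩` on the two qubits `A' B'`. -/
def xProj (s t : ℝ) : Matrix (Fin 2 × Fin 2) (Fin 2 × Fin 2) ℂ := fun x y =>
  xKet s x.1 * xKet t x.2 * star (xKet s y.1 * xKet t y.2)

/-- The phase-error rate `e^X_{m,n} = Tr[ρ^{(m,n)} (|+-⟩⟨+-| + |-+⟩⟨-+|)]` of the normalized state
`ρ^{(m,n)}` (of value `0` if the gain vanishes). -/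
def phaseErrorRate (μ τ : ℝ) (N : Op →ₗ[ℂ] Op) (m n : ℕ) : ℝ :=
  ((((gain μ τ N m n : ℂ)⁻¹ • taggedState μ τ N m n) *
    (xProj 1 (-1) + xProj (-1) 1)).trace).re

/-! ### Hermite-function integrals -/

/-- `c₁`. -/
def cOne (τ : ℝ) : ℝ := ∫ q in regionZero τ,
  (hermiteFun 0 q.1 ^ 2 * hermiteFun 1 q.2 ^ 2 + hermiteFun 0 q.2 ^ 2 * hermiteFun 1 q.1 ^ 2)

/-- `c₂^{02}`. -/
def cTwo02 (τ : ℝ) : ℝ := ∫ q in regionZero τ,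
  (hermiteFun 0 q.1 ^ 2 * hermiteFun 2 q.2 ^ 2 + hermiteFun 2 q.1 ^ 2 * hermiteFun 0 q.2 ^ 2)

/-- `c₂^{11}`. -/
def cTwo11 (τ : ℝ) : ℝ := ∫ q in regionZero τ,
  2 * hermiteFun 1 q.1 ^ 2 * hermiteFun 1 q.2 ^ 2

/-- `d₂`, the interference integral of `|02⟩` and `|20⟩`. -/
def dTwo (τ : ℝ) : ℝ := ∫ q in regionZero τ,
  2 * (hermiteFun 0 q.1 * hermiteFun 2 q.1) * (hermiteFun 0 q.2 * hermiteFun 2 q.2)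

end

end TimeBinCV

/-! On the space of total photon number `n` the phase acts by a scalar,
`P_n |q₁(φ), q₂(φ)⟩ = e^{inφ} P_n |q₁(0), q₂(0)⟩`, so the phase integrals in the squashing map and
in `M_±` disappear and what remains are finite matrices integrated over `R₀`. In the same way the
`m`-photon block of the phase-randomized source is `Pr(m) |Ψ_m⟩⟨Ψ_m|`.

Projecting `A'` onto `|s⟩` turns `|Ψ_m⟩` into `|Ψ_m^s⟩ / √2`, and projecting `B'` onto `|t⟩` turns
`K` into `(⟨q₁, q₂| + t ⟨q₂, q₁|) / √2`. Hence the outcome `(s, t)` of measuring both qubits in the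
`X` basis has weight `½ Pr(m) Tr[N(|Ψ_m^s⟩⟨Ψ_m^s|) P_n M_t P_n]`. The phase error adds up the
outcomes `s ≠ t`, and the gain all four of them. As `A'` is a qubit, `2`-positivity of `N` makes the
unnormalized state on `A' B'` positive, so that these weights are real and the state itself vanishes
when the gain does.

Finally `ψ_n` has the parity of `n`, so the overlap of `ψ_m` and `ψ_n` on `|q| < τ` is zero for odd
`m + n`, which leaves `P_n M_± P_n` with the few entries `c₁`, `c₂^{02}`, `c₂^{11}`, `d₂`. -/

namespace TimeBinCV

open InnerProductSpace MeasureTheory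
open scoped ComplexOrder Kronecker
open Finset.HasAntidiagonal (antidiagonal mem_antidiagonal)

noncomputable section

/-! ### Fock matrix elements and traces -/

theorem inner_fock_left (a : ℕ × ℕ) (x : TwoMode) : inner ℂ (fock a.1 a.2) x = x a := by
  simp [fock, lp.inner_single_left]

theorem inner_fock_right (a : ℕ × ℕ) (x : TwoMode) : inner ℂ x (fock a.1 a.2) = star (x a) := by
  simp [fock, lp.inner_single_right]

theorem inner_fock_fock (a b : ℕ × ℕ) :
    inner ℂ (fock a.1 a.2) (fock b.1 b.2) = if a = b then (1 : ℂ) else 0 := by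
  rw [inner_fock_left, fock, lp.single_apply]
  by_cases h : a = b <;> simp [h]

theorem fockEntry_add (S T : Op) (a b : ℕ × ℕ) :
    fockEntry (S + T) a b = fockEntry S a b + fockEntry T a b := by
  simp [fockEntry]

theorem fockEntry_smul (c : ℂ) (T : Op) (a b : ℕ × ℕ) :
    fockEntry (c • T) a b = c * fockEntry T a b := by
  simp [fockEntry]

theorem inner_sum_fock (s : Finset (ℕ × ℕ)) (X : Op) (f g : ℕ × ℕ → ℂ) :
    inner ℂ (∑ a ∈ s, f a • fock a.1 a.2) (X (∑ b ∈ s, g b • fock b.1 b.2)) =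
      ∑ a ∈ s, ∑ b ∈ s, star (f a) * fockEntry X a b * g b := by
  simp only [map_sum, map_smul, sum_inner]
  simp only [inner_sum, inner_smul_left, inner_smul_right, fockEntry, Complex.star_def]
  exact Finset.sum_congr rfl fun a _ => Finset.sum_congr rfl fun b _ => by ring

/-- The diagonal Fock matrix elements of `T` are summable, so that `opTrace T` is the sum of a
convergent series. -/
def HasFockTrace (T : Op) : Prop := Summable fun a : ℕ × ℕ => fockEntry T a a

theorem HasFockTrace.add {S T : Op} (hS : HasFockTrace S) (hT : HasFockTrace T) :
    HasFockTrace (S + T) := by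
  simpa only [HasFockTrace, fockEntry_add] using Summable.add hS hT

theorem HasFockTrace.smul {T : Op} (hT : HasFockTrace T) (c : ℂ) : HasFockTrace (c • T) := by
  simpa only [HasFockTrace, fockEntry_smul] using Summable.mul_left c hT

theorem hasFockTrace_sum {ι : Type*} {s : Finset ι} {T : ι → Op}
    (hT : ∀ i ∈ s, HasFockTrace (T i)) : HasFockTrace (∑ i ∈ s, T i) := by
  simpa [HasFockTrace, fockEntry] using summable_sum hT

theorem opTrace_add {S T : Op} (hS : HasFockTrace S) (hT : HasFockTrace T) :
    opTrace (S + T) = opTrace S + opTrace T := by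
  simpa only [opTrace, fockEntry_add] using Summable.tsum_add hS hT

theorem opTrace_smul (c : ℂ) (T : Op) : opTrace (c • T) = c * opTrace T := by
  simp only [opTrace, fockEntry_smul, tsum_mul_left]

theorem opTrace_sum {ι : Type*} {s : Finset ι} {T : ι → Op}
    (hT : ∀ i ∈ s, HasFockTrace (T i)) : opTrace (∑ i ∈ s, T i) = ∑ i ∈ s, opTrace (T i) := by
  simpa [opTrace, fockEntry] using Summable.tsum_finsetSum hT

theorem hasSum_fockEntry_comp_ketBra (X : Op) (x y : TwoMode) :
    HasSum (fun a => fockEntry (X ∘L ketBra x y) a a) (inner ℂ y (X x)) := by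
  refine (lp.hasSum_inner y (X x)).congr_fun fun a => ?_
  simp [fockEntry, ketBra, inner_fock_left, inner_fock_right, mul_comm]

theorem hasFockTrace_comp_ketBra (X : Op) (x y : TwoMode) : HasFockTrace (X ∘L ketBra x y) :=
  (hasSum_fockEntry_comp_ketBra X x y).summable

theorem opTrace_comp_ketBra (X : Op) (x y : TwoMode) :
    opTrace (X ∘L ketBra x y) = inner ℂ y (X x) :=
  (hasSum_fockEntry_comp_ketBra X x y).tsum_eq

theorem comp_photonBlock (X : Op) (n : ℕ) (A : Matrix (ℕ × ℕ) (ℕ × ℕ) ℂ) :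
    X ∘L photonBlock n A = ∑ a ∈ antidiagonal n, ∑ b ∈ antidiagonal n,
      A a b • (X ∘L ketBra (fock a.1 a.2) (fock b.1 b.2)) := by
  simp only [photonBlock, ContinuousLinearMap.comp_finsetSum, ContinuousLinearMap.comp_smul]

theorem hasFockTrace_comp_photonBlock (X : Op) (n : ℕ) (A : Matrix (ℕ × ℕ) (ℕ × ℕ) ℂ) :
    HasFockTrace (X ∘L photonBlock n A) := by
  rw [comp_photonBlock]
  exact hasFockTrace_sum fun a _ => hasFockTrace_sum fun b _ =>
    (hasFockTrace_comp_ketBra ..).smul _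

theorem opTrace_comp_photonBlock (X : Op) (n : ℕ) (A : Matrix (ℕ × ℕ) (ℕ × ℕ) ℂ) :
    opTrace (X ∘L photonBlock n A) =
      ∑ a ∈ antidiagonal n, ∑ b ∈ antidiagonal n, A a b * fockEntry X b a := by
  have hterm (a b : ℕ × ℕ) :
      HasFockTrace (A a b • (X ∘L ketBra (fock a.1 a.2) (fock b.1 b.2))) :=
    (hasFockTrace_comp_ketBra ..).smul _
  rw [comp_photonBlock, opTrace_sum fun a _ => hasFockTrace_sum fun b _ => hterm a b]
  refine Finset.sum_congr rfl fun a _ => ?_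
  rw [opTrace_sum fun b _ => hterm a b]
  simp only [opTrace_smul, opTrace_comp_ketBra, fockEntry]

/-! ### Photon-number blocks -/

theorem photonProj_apply (n : ℕ) (x : TwoMode) :
    photonProj n x = ∑ a ∈ antidiagonal n, x a • fock a.1 a.2 := by
  simp only [photonProj, ketBra, sum_apply, rankOne_apply, inner_fock_left]

theorem photonProj_fock (n : ℕ) (b : ℕ × ℕ) :
    photonProj n (fock b.1 b.2) = if b ∈ antidiagonal n then fock b.1 b.2 else 0 := by
  simp [photonProj, ketBra, inner_fock_fock]

theorem inner_photonProj_left (n : ℕ) (x y : TwoMode) :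
    inner ℂ (photonProj n x) y = inner ℂ x (photonProj n y) := by
  simp [photonProj, ketBra, mul_comm]

theorem fockEntry_photonProj_comp (X : Op) (n : ℕ) (a b : ℕ × ℕ) :
    fockEntry (photonProj n ∘L X ∘L photonProj n) a b =
      if a ∈ antidiagonal n ∧ b ∈ antidiagonal n then fockEntry X a b else 0 := by
  simp only [fockEntry, ContinuousLinearMap.comp_apply]
  rw [← inner_photonProj_left, photonProj_fock, photonProj_fock]
  split_ifs <;> simp_all

theorem photonBlock_congr {n : ℕ} {A B : Matrix (ℕ × ℕ) (ℕ × ℕ) ℂ}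
    (h : ∀ a ∈ antidiagonal n, ∀ b ∈ antidiagonal n, A a b = B a b) :
    photonBlock n A = photonBlock n B :=
  Finset.sum_congr rfl fun a ha => Finset.sum_congr rfl fun b hb => by rw [h a ha b hb]

theorem photonBlock_smul (n : ℕ) (c : ℂ) (A : Matrix (ℕ × ℕ) (ℕ × ℕ) ℂ) :
    photonBlock n (c • A) = c • photonBlock n A := by
  simp only [photonBlock, Matrix.smul_apply, smul_assoc, Finset.smul_sum]

theorem photonBlock_mul_star (n : ℕ) (x y : TwoMode) :
    photonBlock n (Matrix.of fun a b => x a * star (y b)) =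
      ketBra (photonProj n x) (photonProj n y) := by
  simp only [photonBlock, Matrix.of_apply, photonProj_apply, ketBra, map_sum, map_smul,
    ContinuousLinearMap.map_smulₛₗ, sum_apply, smul_apply, smul_smul, starRingEnd_apply]
  exact Finset.sum_comm

/-! ### Trace class and positivity -/

theorem absOp_ketBra (x y : TwoMode) :
    absOp (ketBra x y) = ((‖x‖ / ‖y‖ : ℝ) : ℂ) • ketBra y y := by
  refine CFC.sqrt_unique ?_ ((ContinuousLinearMap.nonneg_iff_isPositive _).2
    ((isPositive_rankOne_self y).smul_of_nonneg (Complex.zero_le_real.2 (by positivity))))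
  rcases eq_or_ne y 0 with rfl | hy
  · simp [ketBra]
  have hy' : (‖y‖ : ℂ) ≠ 0 := by exact_mod_cast norm_ne_zero_iff.2 hy
  simp only [ketBra, ContinuousLinearMap.star_eq_adjoint, adjoint_rankOne,
    smul_mul_smul_comm, ContinuousLinearMap.mul_def, rankOne_comp_rankOne,
    inner_self_eq_norm_sq_to_K, smul_smul]
  congr 1
  push_cast
  simp only [Complex.coe_algebraMap]
  field_simp

theorem isTraceClass_ketBra (x y : TwoMode) : IsTraceClass (ketBra x y) := by
  have hdiag : Summable fun a => (fockEntry (ketBra y y) a a).re :=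
    Complex.reCLM.summable (hasSum_fockEntry_comp_ketBra 1 y y).summable
  simpa only [IsTraceClass, absOp_ketBra, fockEntry_smul, Complex.re_ofReal_mul]
    using hdiag.mul_left (‖x‖ / ‖y‖)

theorem blockPositive_ketBra {k : ℕ} (x : Fin k → TwoMode) :
    BlockPositive fun i j => ketBra (x i) (x j) := by
  intro v
  have hsq : ∑ i, ∑ j, inner ℂ (v i) (ketBra (x i) (x j) (v j)) =
      star (∑ i, inner ℂ (x i) (v i)) * ∑ j, inner ℂ (x j) (v j) := by
    simp only [ketBra, inner_right_rankOne_apply, star_sum, Complex.star_def, inner_conj_symm,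
      Finset.sum_mul_sum]
  exact hsq ▸ star_mul_self_nonneg _

/-- `N` is `k`-positive on the trace-class operators: `N ⊗ id` preserves positivity on
`TwoMode ⊗ ℂ^k`. A quantum channel is `k`-positive for every `k`. -/
def IsKPositive (k : ℕ) (N : Op →ₗ[ℂ] Op) : Prop :=
  ∀ ρ : Fin k → Fin k → Op, (∀ i j, IsTraceClass (ρ i j)) → BlockPositive ρ →
    BlockPositive fun i j => N (ρ i j)

theorem IsKPositive.blockPositive_ketBra {k : ℕ} {N : Op →ₗ[ℂ] Op} (hN : IsKPositive k N)
    (x : Fin k → TwoMode) : BlockPositive fun i j => N (ketBra (x i) (x j)) :=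
  hN _ (fun _ _ => isTraceClass_ketBra _ _) (TimeBinCV.blockPositive_ketBra x)

theorem posSemidef_of_forall_nonneg {ι : Type*} [Fintype ι] {A : Matrix ι ι ℂ}
    (h : ∀ w, 0 ≤ star w ⬝ᵥ A.mulVec w) : A.PosSemidef := by
  classical
  rw [← Matrix.isPositive_toEuclideanLin_iff, LinearMap.isPositive_iff_complex]
  intro v
  have hinner : inner ℂ (Matrix.toEuclideanLin A v) v =
      star (star v.ofLp ⬝ᵥ A.mulVec v.ofLp) := by
    rw [← inner_conj_symm, EuclideanSpace.inner_eq_star_dotProduct, Matrix.ofLp_toLpLin,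
      Matrix.toLin'_apply, dotProduct_comm, Complex.star_def]
  have hnonneg : 0 ≤ inner ℂ (Matrix.toEuclideanLin A v) v := hinner ▸ star_nonneg_iff.2 (h v.ofLp)
  exact ⟨(Complex.eq_re_of_ofReal_le hnonneg).symm, (Complex.nonneg_iff.1 hnonneg).1⟩

theorem star_dotProduct_integral_mulVec {α ι : Type*} [Fintype ι] [MeasurableSpace α]
    {μ : Measure α} {A : α → Matrix ι ι ℂ} (hint : ∀ i j, Integrable (fun x => A x i j) μ)
    (w : ι → ℂ) :
    star w ⬝ᵥ (Matrix.of fun i j => ∫ x, A x i j ∂μ).mulVec w =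
      ∫ x, star w ⬝ᵥ (A x).mulVec w ∂μ := by
  simp only [dotProduct, Matrix.mulVec, Matrix.of_apply]
  rw [integral_finsetSum _ fun i _ => (integrable_finsetSum _ fun j _ =>
    (hint i j).mul_const _).const_mul _]
  refine Finset.sum_congr rfl fun i _ => ?_
  rw [integral_const_mul, integral_finsetSum _ fun j _ => (hint i j).mul_const _]
  simp only [integral_mul_const]

theorem posSemidef_integral {α ι : Type*} [Finite ι] [MeasurableSpace α] {μ : Measure α}
    {A : α → Matrix ι ι ℂ} (hA : ∀ x, (A x).PosSemidef)
    (hint : ∀ i j, Integrable (fun x => A x i j) μ) :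
    (Matrix.of fun i j => ∫ x, A x i j ∂μ).PosSemidef := by
  have := Fintype.ofFinite ι
  refine posSemidef_of_forall_nonneg fun w => ?_
  rw [star_dotProduct_integral_mulVec hint]
  exact integral_nonneg fun x => (hA x).dotProduct_mulVec_nonneg w

theorem ofReal_re_trace_mul {ι : Type*} [Fintype ι] {A B : Matrix ι ι ℂ} (hA : A.IsHermitian)
    (hB : B.IsHermitian) : (((A * B).trace.re : ℝ) : ℂ) = (A * B).trace := by
  rw [← Complex.conj_eq_iff_re, ← Complex.star_def, ← Matrix.trace_conjTranspose,
    Matrix.conjTranspose_mul, hA.eq, hB.eq, Matrix.trace_mul_comm]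

theorem trace_mul_vecMulVec_star {ι : Type*} [Fintype ι] (A : Matrix ι ι ℂ) (w : ι → ℂ) :
    (A * Matrix.vecMulVec w (star w)).trace = star w ⬝ᵥ A.mulVec w := by
  rw [Matrix.mul_vecMulVec, Matrix.trace_vecMulVec, dotProduct_comm]

/-! ### Hermite functions -/

theorem hermite_comp_neg_X (n : ℕ) :
    (Polynomial.hermite n).comp (-Polynomial.X) =
      (-1 : Polynomial ℤ) ^ n * Polynomial.hermite n := by
  have hX : (-Polynomial.X : Polynomial ℤ) = Polynomial.C (-1) * Polynomial.X := by simp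
  have hC : (-1 : Polynomial ℤ) ^ n = Polynomial.C ((-1) ^ n) := by simp
  ext k
  rw [hX, hC, Polynomial.comp_C_mul_X_coeff, Polynomial.coeff_C_mul]
  rcases Nat.even_or_odd (n + k) with heven | hodd
  · rw [neg_one_pow_congr (Nat.even_add.1 heven), mul_comm]
  · simp [Polynomial.coeff_hermite_of_odd_add hodd]

theorem hermiteFun_eq (n : ℕ) (q : ℝ) :
    hermiteFun n q = 1 / Real.sqrt (2 ^ n * n.factorial * Real.sqrt (2 * Real.pi)) *
      Real.sqrt 2 ^ n * Polynomial.aeval q (Polynomial.hermite n) * Real.exp (-q ^ 2 / 4) := by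
  have harg : Real.sqrt 2 * (q / Real.sqrt 2) = q := by field_simp
  rw [hermiteFun, physHermite, harg]
  ring

theorem hermiteFun_neg (n : ℕ) (q : ℝ) : hermiteFun n (-q) = (-1) ^ n * hermiteFun n q := by
  have hpoly := congrArg (Polynomial.aeval q) (hermite_comp_neg_X n)
  simp only [Polynomial.aeval_comp, map_neg, Polynomial.aeval_X, map_mul, map_pow, map_one]
    at hpoly
  rw [hermiteFun_eq, hermiteFun_eq, hpoly, neg_sq]
  ring

theorem integrable_polynomial_mul_gaussian (p : Polynomial ℝ) {b : ℝ} (hb : 0 < b) :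
    Integrable fun x : ℝ => p.eval x * Real.exp (-b * x ^ 2) := by
  induction p using Polynomial.induction_on' with
  | add p q hp hq =>
    simp only [Polynomial.eval_add, add_mul]
    exact hp.add hq
  | monomial n a =>
    have hn : (-1 : ℝ) < n := neg_one_lt_zero.trans_le n.cast_nonneg
    simpa [mul_assoc] using (integrable_rpow_mul_exp_neg_mul_sq hb hn).const_mul a

theorem integrable_hermiteFun_mul (m n : ℕ) :
    Integrable fun q : ℝ => hermiteFun m q * hermiteFun n q := by
  have hpoly := integrable_polynomial_mul_gaussian
    ((Polynomial.hermite m * Polynomial.hermite n).map (Int.castRingHom ℝ)) one_half_pos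
  refine (hpoly.const_mul
    (1 / Real.sqrt (2 ^ m * m.factorial * Real.sqrt (2 * Real.pi)) * Real.sqrt 2 ^ m *
      (1 / Real.sqrt (2 ^ n * n.factorial * Real.sqrt (2 * Real.pi)) * Real.sqrt 2 ^ n))).congr
    (.of_forall fun q => ?_)
  have hexp : Real.exp (-(1 / 2) * q ^ 2) = Real.exp (-q ^ 2 / 4) * Real.exp (-q ^ 2 / 4) := by
    rw [← Real.exp_add]; ring_nf
  simp only [hermiteFun_eq, hexp, Polynomial.map_mul, Polynomial.eval_mul, Polynomial.aeval_def,
    Polynomial.eval_map, algebraMap_int_eq]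
  ring

/-- The overlap of `ψ_m` and `ψ_n` below the threshold, `∫_{|x| < τ} ψ_m ψ_n`. -/
def innerOverlap (τ : ℝ) (m n : ℕ) : ℝ :=
  ∫ x in {x : ℝ | |x| < τ}, hermiteFun m x * hermiteFun n x

/-- The overlap of `ψ_m` and `ψ_n` above the threshold, `∫_{|x| > τ} ψ_m ψ_n`. -/
def outerOverlap (τ : ℝ) (m n : ℕ) : ℝ :=
  ∫ x in {x : ℝ | τ < |x|}, hermiteFun m x * hermiteFun n x

theorem innerOverlap_comm (τ : ℝ) (m n : ℕ) : innerOverlap τ m n = innerOverlap τ n m := by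
  simp only [innerOverlap, mul_comm]

theorem outerOverlap_comm (τ : ℝ) (m n : ℕ) : outerOverlap τ m n = outerOverlap τ n m := by
  simp only [outerOverlap, mul_comm]

theorem integral_eq_zero_of_odd {f : ℝ → ℝ} (hf : Function.Odd f) : ∫ x, f x = 0 := by
  have hneg := integral_neg_eq_self f volume
  simp only [hf _, integral_neg] at hneg
  exact self_eq_neg.1 hneg.symm

theorem innerOverlap_eq_zero_of_odd (τ : ℝ) {m n : ℕ} (h : Odd (m + n)) :
    innerOverlap τ m n = 0 := by
  rw [innerOverlap, ← integral_indicator (measurableSet_lt (by fun_prop) (by fun_prop))]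
  refine integral_eq_zero_of_odd fun x => ?_
  have hodd : hermiteFun m (-x) * hermiteFun n (-x) = -(hermiteFun m x * hermiteFun n x) := by
    rw [hermiteFun_neg, hermiteFun_neg, mul_mul_mul_comm, ← pow_add, h.neg_one_pow, neg_one_mul]
  by_cases hx : |x| < τ <;> simp [hx, hodd]

theorem regionZero_eq_prod (τ : ℝ) :
    regionZero τ = {x : ℝ | |x| < τ} ×ˢ {x : ℝ | τ < |x|} := rfl

/-- The two-mode wave function `ψ_k(q₁) ψ_l(q₂)` of the Fock state `a = (k, l)`. -/
def hermiteFun₂ (q : ℝ × ℝ) (a : ℕ × ℕ) : ℝ := hermiteFun a.1 q.1 * hermiteFun a.2 q.2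

theorem hermiteFun₂_mul (q : ℝ × ℝ) (a b : ℕ × ℕ) :
    hermiteFun₂ q a * hermiteFun₂ q b =
      hermiteFun a.1 q.1 * hermiteFun b.1 q.1 * (hermiteFun a.2 q.2 * hermiteFun b.2 q.2) :=
  mul_mul_mul_comm ..

theorem setIntegral_hermiteFun₂_mul (τ : ℝ) (a b : ℕ × ℕ) :
    ∫ q in regionZero τ, hermiteFun₂ q a * hermiteFun₂ q b =
      innerOverlap τ a.1 b.1 * outerOverlap τ a.2 b.2 := by
  simp only [hermiteFun₂_mul, regionZero_eq_prod]
  exact setIntegral_prod_mul (fun x => hermiteFun a.1 x * hermiteFun b.1 x)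
    (fun x => hermiteFun a.2 x * hermiteFun b.2 x) _ _

theorem integrable_hermiteFun₂_mul (a b : ℕ × ℕ) :
    Integrable fun q => hermiteFun₂ q a * hermiteFun₂ q b := by
  simp only [hermiteFun₂_mul]
  exact (integrable_hermiteFun_mul a.1 b.1).mul_prod (integrable_hermiteFun_mul a.2 b.2)

theorem setIntegral_hermiteFun₂_sq_add_sq (τ : ℝ) (m n : ℕ) :
    ∫ q in regionZero τ, (hermiteFun₂ q (m, n) * hermiteFun₂ q (m, n) +
        hermiteFun₂ q (n, m) * hermiteFun₂ q (n, m)) =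
      innerOverlap τ m m * outerOverlap τ n n + innerOverlap τ n n * outerOverlap τ m m := by
  rw [integral_add (integrable_hermiteFun₂_mul ..).integrableOn
    (integrable_hermiteFun₂_mul ..).integrableOn]
  simp only [setIntegral_hermiteFun₂_mul]

theorem cOne_eq (τ : ℝ) : cOne τ =
    innerOverlap τ 0 0 * outerOverlap τ 1 1 + innerOverlap τ 1 1 * outerOverlap τ 0 0 := by
  rw [← setIntegral_hermiteFun₂_sq_add_sq, cOne]
  congr 1 with q
  simp only [hermiteFun₂]
  ring

theorem cTwo02_eq (τ : ℝ) : cTwo02 τ =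
    innerOverlap τ 0 0 * outerOverlap τ 2 2 + innerOverlap τ 2 2 * outerOverlap τ 0 0 := by
  rw [← setIntegral_hermiteFun₂_sq_add_sq, cTwo02]
  congr 1 with q
  simp only [hermiteFun₂]
  ring

theorem cTwo11_eq (τ : ℝ) : cTwo11 τ = 2 * (innerOverlap τ 1 1 * outerOverlap τ 1 1) := by
  rw [← setIntegral_hermiteFun₂_mul τ (1, 1) (1, 1), ← integral_const_mul, cTwo11]
  congr 1 with q
  simp only [hermiteFun₂]
  ring

theorem dTwo_eq (τ : ℝ) : dTwo τ = 2 * (innerOverlap τ 0 2 * outerOverlap τ 0 2) := by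
  rw [← setIntegral_hermiteFun₂_mul τ (0, 0) (2, 2), ← integral_const_mul, dTwo]
  congr 1 with q
  simp only [hermiteFun₂]
  ring

/-! ### Detection in a fixed photon-number space -/

theorem star_exp_I_mul_mul_self (n : ℕ) (φ : ℝ) :
    star (Complex.exp (Complex.I * n * φ)) * Complex.exp (Complex.I * n * φ) = 1 := by
  rw [Complex.star_def, ← Complex.exp_conj, ← Complex.exp_add]
  simp

theorem phaseAverage_const (c : ℂ) :
    ∫ _φ in (0 : ℝ)..(2 * Real.pi), (1 / (2 * Real.pi) : ℂ) * c = c := by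
  have hpi : (Real.pi : ℂ) ≠ 0 := by exact_mod_cast Real.pi_ne_zero
  rw [intervalIntegral.integral_const, sub_zero, Complex.real_smul]
  push_cast
  field_simp

theorem quadKet₂_eq (q₁ q₂ φ : ℝ) {n : ℕ} {a : ℕ × ℕ} (ha : a ∈ antidiagonal n) :
    quadKet₂ q₁ q₂ φ a = hermiteFun₂ (q₁, q₂) a * Complex.exp (Complex.I * n * φ) := by
  have hexp : Complex.exp (Complex.I * n * φ) =
      Complex.exp (Complex.I * a.1 * φ) * Complex.exp (Complex.I * a.2 * φ) := by
    rw [← Complex.exp_add, ← mem_antidiagonal.1 ha]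
    push_cast
    ring_nf
  rw [hexp, quadKet₂, quadKet, quadKet, hermiteFun₂]
  push_cast
  ring

/-- The value `⟨a|K†|k⟩` at phase `φ = 0`: the two-mode wave function at `q` for the key bit
`k = 0`, and at the exchanged quadratures for `k = 1`. -/
def keyAmp (q : ℝ × ℝ) (k : Fin 2) (a : ℕ × ℕ) : ℝ := hermiteFun₂ q (if k = 0 then a else a.swap)

theorem star_krausAmp_eq (q : ℝ × ℝ) (φ : ℝ) (k : Fin 2) {n : ℕ} {a : ℕ × ℕ}
    (ha : a ∈ antidiagonal n) :
    star (krausAmp q.1 q.2 φ k a) = keyAmp q k a * Complex.exp (Complex.I * n * φ) := by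
  rw [krausAmp, star_star, quadKet₂_eq _ _ _ ha, quadKet₂_eq _ _ _ ha, keyAmp]
  split_ifs
  · rfl
  · simp only [hermiteFun₂, Prod.fst_swap, Prod.snd_swap, mul_comm (hermiteFun a.1 q.2)]

/-- The vector `P_n K† |k⟩` at phase `φ = 0`. The phase is irrelevant because
`P_n |q₁(φ), q₂(φ)⟩ = e^{inφ} P_n |q₁(0), q₂(0)⟩`. -/
def keyKet (n : ℕ) (q : ℝ × ℝ) (k : Fin 2) : TwoMode :=
  ∑ a ∈ antidiagonal n, (keyAmp q k a : ℂ) • fock a.1 a.2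

theorem inner_keyKet (X : Op) (n : ℕ) (q : ℝ × ℝ) (k l : Fin 2) :
    inner ℂ (keyKet n q k) (X (keyKet n q l)) = ∑ a ∈ antidiagonal n, ∑ b ∈ antidiagonal n,
      fockEntry X a b * ((keyAmp q k a * keyAmp q l b : ℝ) : ℂ) := by
  rw [keyKet, keyKet, inner_sum_fock]
  refine Finset.sum_congr rfl fun a _ => Finset.sum_congr rfl fun b _ => ?_
  rw [Complex.star_def, Complex.conj_ofReal]
  push_cast
  ring

theorem integrable_inner_keyKet (X : Op) (n : ℕ) (k l : Fin 2) :
    Integrable fun q => inner ℂ (keyKet n q k) (X (keyKet n q l)) := by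
  simp only [inner_keyKet]
  exact integrable_finsetSum _ fun a _ => integrable_finsetSum _ fun b _ =>
    (integrable_hermiteFun₂_mul _ _).ofReal.const_mul _

theorem tsum_krausAmp_mul_photonProj (X : Op) (n : ℕ) (q : ℝ × ℝ) (φ : ℝ) (k l : Fin 2) :
    ∑' a : ℕ × ℕ, ∑' b : ℕ × ℕ, krausAmp q.1 q.2 φ k a *
        fockEntry (photonProj n ∘L X ∘L photonProj n) a b * star (krausAmp q.1 q.2 φ l b) =
      inner ℂ (keyKet n q k) (X (keyKet n q l)) := by
  simp only [fockEntry_photonProj_comp]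
  rw [inner_keyKet, tsum_eq_sum (s := antidiagonal n) fun a ha => by simp [ha]]
  refine Finset.sum_congr rfl fun a ha => ?_
  rw [tsum_eq_sum (s := antidiagonal n) fun b hb => by simp [hb]]
  refine Finset.sum_congr rfl fun b hb => ?_
  have hphase := star_exp_I_mul_mul_self n φ
  rw [if_pos ⟨ha, hb⟩, ← star_star (krausAmp q.1 q.2 φ k a), star_krausAmp_eq q φ k ha,
    star_krausAmp_eq q φ l hb]
  simp only [star_mul', Complex.star_def, Complex.conj_ofReal] at hphase ⊢
  push_cast
  linear_combination (keyAmp q k a : ℂ) * fockEntry X a b * keyAmp q l b * hphase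

theorem squash_photonProj (τ : ℝ) (X : Op) (n : ℕ) (k l : Fin 2) :
    squash τ (photonProj n ∘L X ∘L photonProj n) k l =
      ∫ q in regionZero τ, inner ℂ (keyKet n q k) (X (keyKet n q l)) := by
  simp only [squash, tsum_krausAmp_mul_photonProj, phaseAverage_const]

/-- The amplitude `⟨a|(|q₁, q₂⟩ + s |q₂, q₁⟩)` at phase `φ = 0`, used for `s = ±1`. -/
def compAmp (s : ℝ) (q : ℝ × ℝ) (a : ℕ × ℕ) : ℝ := keyAmp q 0 a + s * keyAmp q 1 a

theorem quadKet₂_add_smul_swap_eq (s : ℝ) (q : ℝ × ℝ) (φ : ℝ) {n : ℕ} {a : ℕ × ℕ}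
    (ha : a ∈ antidiagonal n) :
    quadKet₂ q.1 q.2 φ a + s * quadKet₂ q.2 q.1 φ a =
      compAmp s q a * Complex.exp (Complex.I * n * φ) := by
  have hzero := star_krausAmp_eq q φ 0 ha
  have hone := star_krausAmp_eq q φ 1 ha
  simp only [krausAmp, star_star, if_true, one_ne_zero, if_false] at hzero hone
  rw [hzero, hone, compAmp]
  push_cast
  ring

theorem compOp_eq (τ s : ℝ) {n : ℕ} {a b : ℕ × ℕ} (ha : a ∈ antidiagonal n)
    (hb : b ∈ antidiagonal n) :
    compOp τ s a b =
      (1 / 2 : ℂ) * ∫ q in regionZero τ, ((compAmp s q a * compAmp s q b : ℝ) : ℂ) := by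
  have hprod (q : ℝ × ℝ) (φ : ℝ) :
      (quadKet₂ q.1 q.2 φ a + s * quadKet₂ q.2 q.1 φ a) *
          star (quadKet₂ q.1 q.2 φ b + s * quadKet₂ q.2 q.1 φ b) =
        ((compAmp s q a * compAmp s q b : ℝ) : ℂ) := by
    have hphase := star_exp_I_mul_mul_self n φ
    rw [quadKet₂_add_smul_swap_eq s q φ ha, quadKet₂_add_smul_swap_eq s q φ hb, star_mul',
      Complex.star_def, Complex.conj_ofReal, ← Complex.star_def]
    push_cast
    linear_combination (compAmp s q a : ℂ) * compAmp s q b * hphase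
  simp only [compOp, hprod, phaseAverage_const]

theorem compAmp_mul (s : ℝ) (q : ℝ × ℝ) (a b : ℕ × ℕ) :
    compAmp s q a * compAmp s q b =
      hermiteFun₂ q a * hermiteFun₂ q b + s * (hermiteFun₂ q a * hermiteFun₂ q b.swap) +
        s * (hermiteFun₂ q a.swap * hermiteFun₂ q b) +
        s ^ 2 * (hermiteFun₂ q a.swap * hermiteFun₂ q b.swap) := by
  simp only [compAmp, keyAmp, if_true, one_ne_zero, if_false]
  ring

theorem integrable_compAmp_mul (s : ℝ) (a b : ℕ × ℕ) :
    Integrable fun q => compAmp s q a * compAmp s q b := by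
  simp only [compAmp_mul]
  exact (((integrable_hermiteFun₂_mul _ _).add ((integrable_hermiteFun₂_mul _ _).const_mul _)).add
    ((integrable_hermiteFun₂_mul _ _).const_mul _)).add
    ((integrable_hermiteFun₂_mul _ _).const_mul _)

theorem compOp_apply (τ s : ℝ) {i j k l : ℕ} (h : i + j = k + l) :
    compOp τ s (i, j) (k, l) = (1 / 2 : ℂ) *
      (innerOverlap τ i k * outerOverlap τ j l + s * (innerOverlap τ i l * outerOverlap τ j k) +
        s * (innerOverlap τ j k * outerOverlap τ i l) +
        s ^ 2 * (innerOverlap τ j l * outerOverlap τ i k)) := by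
  have hint (a b : ℕ × ℕ) :
      IntegrableOn (fun q => hermiteFun₂ q a * hermiteFun₂ q b) (regionZero τ) :=
    (integrable_hermiteFun₂_mul a b).integrableOn
  rw [compOp_eq τ s (n := k + l) (mem_antidiagonal.2 h) (mem_antidiagonal.2 rfl),
    integral_complex_ofReal]
  simp only [compAmp_mul]
  rw [integral_add (((hint _ _).fun_add ((hint _ _).const_mul s)).fun_add ((hint _ _).const_mul s))
      ((hint _ _).const_mul _),
    integral_add ((hint _ _).fun_add ((hint _ _).const_mul s)) ((hint _ _).const_mul s),
    integral_add (hint _ _) ((hint _ _).const_mul s)]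
  simp only [integral_const_mul, setIntegral_hermiteFun₂_mul, Prod.fst_swap, Prod.snd_swap]
  push_cast
  ring

/-- The vector `P_n (|q₁, q₂⟩ + s |q₂, q₁⟩)` at phase `φ = 0`, used for `s = ±1`. -/
def compKet (n : ℕ) (s : ℝ) (q : ℝ × ℝ) : TwoMode := keyKet n q 0 + (s : ℂ) • keyKet n q 1

theorem compKet_eq_sum (n : ℕ) (s : ℝ) (q : ℝ × ℝ) :
    compKet n s q = ∑ a ∈ antidiagonal n, (compAmp s q a : ℂ) • fock a.1 a.2 := by
  simp only [compKet, keyKet, Finset.smul_sum, ← Finset.sum_add_distrib, smul_smul, ← add_smul,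
    compAmp]
  push_cast
  rfl

theorem inner_compKet (X : Op) (n : ℕ) (s : ℝ) (q : ℝ × ℝ) :
    inner ℂ (compKet n s q) (X (compKet n s q)) = ∑ a ∈ antidiagonal n, ∑ b ∈ antidiagonal n,
      ((compAmp s q a * compAmp s q b : ℝ) : ℂ) * fockEntry X b a := by
  rw [compKet_eq_sum, inner_sum_fock, Finset.sum_comm]
  refine Finset.sum_congr rfl fun a _ => Finset.sum_congr rfl fun b _ => ?_
  rw [Complex.star_def, Complex.conj_ofReal]
  push_cast
  ring

theorem opTrace_comp_photonBlock_compOp (X : Op) (n : ℕ) (τ s : ℝ) :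
    opTrace (X ∘L photonBlock n (compOp τ s)) =
      (1 / 2 : ℂ) * ∫ q in regionZero τ, inner ℂ (compKet n s q) (X (compKet n s q)) := by
  have hint (a b : ℕ × ℕ) : IntegrableOn (fun q => ((compAmp s q a * compAmp s q b : ℝ) : ℂ) *
      fockEntry X b a) (regionZero τ) :=
    ((integrable_compAmp_mul s a b).ofReal.mul_const _).integrableOn
  simp only [inner_compKet]
  rw [opTrace_comp_photonBlock, integral_finsetSum _ fun a _ => integrable_finsetSum _ fun b _ =>
    hint a b, Finset.mul_sum]
  refine Finset.sum_congr rfl fun a ha => ?_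
  rw [integral_finsetSum _ fun b _ => hint a b, Finset.mul_sum]
  refine Finset.sum_congr rfl fun b hb => ?_
  rw [compOp_eq τ s ha hb, integral_mul_const, mul_assoc]

/-! ### The source in a fixed photon-number space -/

theorem star_one_div_sqrt_two : star (1 / Real.sqrt 2 : ℂ) = 1 / Real.sqrt 2 := by
  rw [star_div₀, star_one, Complex.star_def, Complex.conj_ofReal]

theorem one_div_sqrt_two_mul_self : (1 / Real.sqrt 2 : ℂ) * (1 / Real.sqrt 2) = 1 / 2 := by
  have hsqrt : (Real.sqrt 2 : ℂ) * Real.sqrt 2 = 2 := by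
    exact_mod_cast Real.mul_self_sqrt zero_le_two
  rw [div_mul_div_comm, hsqrt, one_mul]

theorem coherentAmp_zero (n : ℕ) : coherentAmp 0 n = if n = 0 then 1 else 0 := by
  by_cases h : n = 0 <;> simp [coherentAmp, h]

theorem coherentAmp_mul_star (α : ℂ) (m : ℕ) :
    coherentAmp α m * star (coherentAmp α m) = prPhoton (‖α‖ ^ 2) m := by
  have hnorm : ‖coherentAmp α m‖ = Real.exp (-‖α‖ ^ 2 / 2) * ‖α‖ ^ m / Real.sqrt m.factorial := by
    rw [coherentAmp, norm_div, norm_mul, norm_pow, Complex.norm_real, Complex.norm_real,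
      Real.norm_of_nonneg (Real.exp_nonneg _), Real.norm_of_nonneg (Real.sqrt_nonneg _)]
  rw [Complex.star_def, Complex.mul_conj', hnorm, ← Complex.ofReal_pow, div_pow, mul_pow,
    Real.sq_sqrt (Nat.cast_nonneg _), ← Real.exp_nat_mul, prPhoton, pow_right_comm]
  congr 4
  push_cast
  ring

theorem norm_sqrt_mul_exp_I_mul_sq {μ : ℝ} (hμ : 0 ≤ μ) (φ : ℝ) :
    ‖(Real.sqrt μ : ℂ) * Complex.exp (Complex.I * φ)‖ ^ 2 = μ := by
  rw [norm_mul, mul_comm Complex.I, Complex.norm_exp_ofReal_mul_I, mul_one, Complex.norm_real,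
    Real.norm_of_nonneg (Real.sqrt_nonneg μ), Real.sq_sqrt hμ]

theorem psi_apply (m : ℕ) (i : Fin 2) (a : ℕ × ℕ) :
    psi m i a =
      (1 / Real.sqrt 2 : ℂ) * if a = (if i = 0 then (0, m) else (m, 0)) then 1 else 0 := by
  rw [← inner_fock_fock a, ← inner_smul_right, psi, ← inner_fock_left]
  split_ifs <;> rfl

theorem photonProj_psi (m : ℕ) (i : Fin 2) : photonProj m (psi m i) = psi m i := by
  have hzero := photonProj_fock m (0, m)
  have hone := photonProj_fock m (m, 0)
  simp only [mem_antidiagonal, zero_add, add_zero, if_true] at hzero hone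
  rw [psi, map_smul]
  split_ifs
  · rw [hzero]
  · rw [hone]

theorem sourceAmp_eq (μ φ : ℝ) (i : Fin 2) {m : ℕ} {a : ℕ × ℕ} (ha : a ∈ antidiagonal m) :
    sourceAmp μ φ i a =
      coherentAmp ((Real.sqrt μ : ℂ) * Complex.exp (Complex.I * φ)) m * psi m i a := by
  obtain ⟨k, l⟩ := a
  obtain rfl : k + l = m := mem_antidiagonal.1 ha
  rw [psi_apply]
  by_cases hi : i = 0
  · by_cases hk : k = 0 <;> simp [sourceAmp, coherentAmp_zero, hi, hk, mul_comm]
  · by_cases hl : l = 0 <;> simp [sourceAmp, coherentAmp_zero, hi, hl, mul_comm]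

theorem source_apply {μ : ℝ} (hμ : 0 ≤ μ) (i j : Fin 2) {m : ℕ} {a b : ℕ × ℕ}
    (ha : a ∈ antidiagonal m) (hb : b ∈ antidiagonal m) :
    source μ i j a b = prPhoton μ m * (psi m i a * star (psi m j b)) := by
  have hprod (φ : ℝ) : sourceAmp μ φ i a * star (sourceAmp μ φ j b) =
      prPhoton μ m * (psi m i a * star (psi m j b)) := by
    rw [sourceAmp_eq μ φ i ha, sourceAmp_eq μ φ j hb, star_mul', mul_mul_mul_comm,
      coherentAmp_mul_star, norm_sqrt_mul_exp_I_mul_sq hμ]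
  simp only [source, hprod, phaseAverage_const]

theorem photonBlock_source {μ : ℝ} (hμ : 0 ≤ μ) (m : ℕ) (i j : Fin 2) :
    photonBlock m (source μ i j) = (prPhoton μ m : ℂ) • ketBra (psi m i) (psi m j) := by
  calc photonBlock m (source μ i j)
      = photonBlock m ((prPhoton μ m : ℂ) • Matrix.of fun a b => psi m i a * star (psi m j b)) :=
        photonBlock_congr fun a ha b hb => source_apply hμ i j ha hb
    _ = (prPhoton μ m : ℂ) • ketBra (psi m i) (psi m j) := by
        rw [photonBlock_smul, photonBlock_mul_star, photonProj_psi, photonProj_psi]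

theorem psiPM_eq (m : ℕ) (s : ℝ) : psiPM m s = psi m 0 + (s : ℂ) • psi m 1 := by
  simp only [psiPM, psi, if_true, one_ne_zero, if_false]
  module

theorem prPhoton_pos {μ : ℝ} (hμ : 0 < μ) (m : ℕ) : 0 < prPhoton μ m := by
  unfold prPhoton; positivity

/-! ### The tagged state -/

/-- The integrand of the unnormalized state on `A' B'`: the matrix `⟨k| K N(|Ψ_m⟩⟨Ψ_m|) K† |l⟩`
(`N` acting trivially on `A'`) for detected quadratures `q`. -/
def outcomeState (N : Op →ₗ[ℂ] Op) (m n : ℕ) (q : ℝ × ℝ) :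
    Matrix (Fin 2 × Fin 2) (Fin 2 × Fin 2) ℂ := fun x y =>
  inner ℂ (keyKet n q x.2) (N (ketBra (psi m x.1) (psi m y.1)) (keyKet n q y.2))

theorem taggedState_eq {μ : ℝ} (hμ : 0 ≤ μ) (τ : ℝ) (N : Op →ₗ[ℂ] Op) (m n : ℕ) :
    taggedState μ τ N m n = (prPhoton μ m : ℂ) •
      Matrix.of fun x y => ∫ q in regionZero τ, outcomeState N m n q x y := by
  ext x y
  rw [taggedState, photonBlock_source hμ, map_smul, squash_photonProj, Matrix.smul_apply,
    Matrix.of_apply, smul_eq_mul, ← integral_const_mul]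
  simp only [smul_apply, inner_smul_right, outcomeState]

theorem integrable_outcomeState (N : Op →ₗ[ℂ] Op) (m n : ℕ) (x y : Fin 2 × Fin 2) :
    Integrable fun q => outcomeState N m n q x y :=
  integrable_inner_keyKet _ n x.2 y.2

theorem star_dotProduct_outcomeState_mulVec (N : Op →ₗ[ℂ] Op) (m n : ℕ) (q : ℝ × ℝ)
    (w : Fin 2 × Fin 2 → ℂ) :
    star w ⬝ᵥ (outcomeState N m n q).mulVec w = ∑ i, ∑ j,
      inner ℂ (∑ k, w (i, k) • keyKet n q k)
        (N (ketBra (psi m i) (psi m j)) (∑ l, w (j, l) • keyKet n q l)) := by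
  simp only [dotProduct, Matrix.mulVec, Fintype.sum_prod_type, Finset.mul_sum, outcomeState,
    Pi.star_apply, map_sum, map_smul, sum_inner, inner_sum, inner_smul_left, inner_smul_right,
    Complex.star_def]
  refine Finset.sum_congr rfl fun i _ => ?_
  rw [Finset.sum_comm]
  refine Finset.sum_congr rfl fun j _ => ?_
  rw [Finset.sum_comm]
  exact Finset.sum_congr rfl fun l _ => Finset.sum_congr rfl fun k _ => by ring

theorem posSemidef_outcomeState {N : Op →ₗ[ℂ] Op} (hN : IsKPositive 2 N) (m n : ℕ) (q : ℝ × ℝ) :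
    (outcomeState N m n q).PosSemidef :=
  posSemidef_of_forall_nonneg fun w =>
    star_dotProduct_outcomeState_mulVec N m n q w ▸ hN.blockPositive_ketBra (psi m) _

theorem posSemidef_taggedState {μ : ℝ} (hμ : 0 ≤ μ) (τ : ℝ) {N : Op →ₗ[ℂ] Op}
    (hN : IsKPositive 2 N) (m n : ℕ) : (taggedState μ τ N m n).PosSemidef := by
  have hpr : (0 : ℂ) ≤ prPhoton μ m := by
    unfold prPhoton; norm_cast; positivity
  rw [taggedState_eq hμ]
  exact (posSemidef_integral (posSemidef_outcomeState hN m n)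
    fun x y => (integrable_outcomeState N m n x y).integrableOn).smul hpr

theorem isHermitian_xProj (s t : ℝ) : (xProj s t).IsHermitian := by
  ext x y
  simp only [Matrix.conjTranspose_apply, xProj, star_mul', star_star]
  ring

theorem ofReal_gain {μ : ℝ} (hμ : 0 ≤ μ) (τ : ℝ) {N : Op →ₗ[ℂ] Op} (hN : IsKPositive 2 N)
    (m n : ℕ) : (gain μ τ N m n : ℂ) = (taggedState μ τ N m n).trace := by
  have htrace := ofReal_re_trace_mul (posSemidef_taggedState hμ τ hN m n).isHermitian
    Matrix.isHermitian_one
  rwa [mul_one] at htrace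

theorem ofReal_gain_mul_phaseErrorRate {μ : ℝ} (hμ : 0 ≤ μ) (τ : ℝ) {N : Op →ₗ[ℂ] Op}
    (hN : IsKPositive 2 N) (m n : ℕ) :
    ((gain μ τ N m n * phaseErrorRate μ τ N m n : ℝ) : ℂ) =
      (taggedState μ τ N m n * (xProj 1 (-1) + xProj (-1) 1)).trace := by
  have hpos := posSemidef_taggedState hμ τ hN m n
  by_cases hgain : gain μ τ N m n = 0
  · have hstate : taggedState μ τ N m n = 0 := by
      rw [← hpos.trace_eq_zero_iff, ← ofReal_gain hμ τ hN, hgain, Complex.ofReal_zero]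
    simp [hgain, hstate]
  · rw [← ofReal_re_trace_mul hpos.isHermitian
      ((isHermitian_xProj 1 (-1)).add (isHermitian_xProj (-1) 1)), phaseErrorRate,
      Matrix.smul_mul, Matrix.trace_smul, smul_eq_mul, ← Complex.ofReal_inv, Complex.re_ofReal_mul,
      mul_inv_cancel_left₀ hgain]

/-! ### Measuring both qubits in the `X` basis -/

theorem star_xKet (s : ℝ) (i : Fin 2) : star (xKet s i) = xKet s i := by
  rw [xKet, star_mul', star_one_div_sqrt_two]
  split_ifs <;> simp

theorem sum_xKet_smul_psi (m : ℕ) (s : ℝ) :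
    ∑ i, xKet s i • psi m i = (1 / Real.sqrt 2 : ℂ) • psiPM m s := by
  simp only [Fin.sum_univ_two, xKet, psiPM_eq, if_true, one_ne_zero, if_false]
  module

theorem sum_xKet_smul_keyKet (n : ℕ) (q : ℝ × ℝ) (t : ℝ) :
    ∑ k, xKet t k • keyKet n q k = (1 / Real.sqrt 2 : ℂ) • compKet n t q := by
  simp only [Fin.sum_univ_two, xKet, compKet, if_true, one_ne_zero, if_false]
  module

theorem xProj_eq_vecMulVec (s t : ℝ) :
    xProj s t = Matrix.vecMulVec (fun x => xKet s x.1 * xKet t x.2)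
      (star fun x => xKet s x.1 * xKet t x.2) := rfl

theorem ketBra_smul_smul (c d : ℂ) (x y : TwoMode) :
    ketBra (c • x) (d • y) = (c * star d) • ketBra x y := by
  simp only [ketBra, map_smul, ContinuousLinearMap.map_smulₛₗ, smul_apply, smul_smul,
    starRingEnd_apply]

theorem ketBra_sum_smul {ι : Type*} [Fintype ι] (u : ι → ℂ) (x : ι → TwoMode) :
    ketBra (∑ i, u i • x i) (∑ i, u i • x i) =
      ∑ i, ∑ j, (u i * star (u j)) • ketBra (x i) (x j) := by
  simp only [← ketBra_smul_smul]
  simp only [ketBra, map_sum, sum_apply]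
  exact Finset.sum_comm

theorem star_dotProduct_outcomeState_mulVec_prod (N : Op →ₗ[ℂ] Op) (m n : ℕ) (q : ℝ × ℝ)
    (u v : Fin 2 → ℂ) :
    star (fun x : Fin 2 × Fin 2 => u x.1 * v x.2) ⬝ᵥ
        (outcomeState N m n q).mulVec (fun x => u x.1 * v x.2) =
      inner ℂ (∑ k, v k • keyKet n q k)
        (N (ketBra (∑ i, star (u i) • psi m i) (∑ i, star (u i) • psi m i))
          (∑ k, v k • keyKet n q k)) := by
  have hpull (i : Fin 2) : ∑ k, (u i * v k) • keyKet n q k = u i • ∑ k, v k • keyKet n q k := by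
    simp only [Finset.smul_sum, smul_smul]
  rw [star_dotProduct_outcomeState_mulVec, ketBra_sum_smul]
  simp only [hpull]
  generalize ∑ k, v k • keyKet n q k = y
  simp only [map_sum, map_smul, sum_apply, smul_apply, inner_sum, inner_smul_left,
    inner_smul_right, star_star, starRingEnd_apply]
  exact Finset.sum_congr rfl fun i _ => Finset.sum_congr rfl fun j _ => by ring

theorem trace_outcomeState_mul_xProj (N : Op →ₗ[ℂ] Op) (m n : ℕ) (q : ℝ × ℝ) (s t : ℝ) :
    (outcomeState N m n q * xProj s t).trace = (1 / 4 : ℂ) *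
      inner ℂ (compKet n t q) (N (ketBra (psiPM m s) (psiPM m s)) (compKet n t q)) := by
  rw [xProj_eq_vecMulVec, trace_mul_vecMulVec_star, star_dotProduct_outcomeState_mulVec_prod]
  simp only [star_xKet, sum_xKet_smul_psi, sum_xKet_smul_keyKet, ketBra_smul_smul,
    star_one_div_sqrt_two, one_div_sqrt_two_mul_self, map_smul, smul_apply, inner_smul_left,
    inner_smul_right, starRingEnd_apply]
  linear_combination (1 / 2 : ℂ) * inner ℂ (compKet n t q)
    (N (ketBra (psiPM m s) (psiPM m s)) (compKet n t q)) * one_div_sqrt_two_mul_self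

theorem trace_taggedState_mul_xProj {μ : ℝ} (hμ : 0 ≤ μ) (τ : ℝ) (N : Op →ₗ[ℂ] Op) (m n : ℕ)
    (s t : ℝ) :
    (taggedState μ τ N m n * xProj s t).trace = prPhoton μ m * ((1 / 2 : ℂ) *
      opTrace (N (ketBra (psiPM m s) (psiPM m s)) ∘L photonBlock n (compOp τ t))) := by
  rw [taggedState_eq hμ, Matrix.smul_mul, Matrix.trace_smul, xProj_eq_vecMulVec,
    trace_mul_vecMulVec_star, star_dotProduct_integral_mulVec
      fun x y => (integrable_outcomeState N m n x y).integrableOn]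
  simp only [← trace_mul_vecMulVec_star, ← xProj_eq_vecMulVec, trace_outcomeState_mul_xProj]
  rw [integral_const_mul, opTrace_comp_photonBlock_compOp, smul_eq_mul]
  ring

theorem xProj_eq_kronecker (s t : ℝ) :
    xProj s t = Matrix.vecMulVec (xKet s) (star (xKet s)) ⊗ₖ
      Matrix.vecMulVec (xKet t) (star (xKet t)) := by
  ext x y
  simp only [xProj, Matrix.kroneckerMap_apply, Matrix.vecMulVec_apply, star_mul', Pi.star_apply]
  ring

theorem vecMulVec_xKet_one_add_neg_one :
    Matrix.vecMulVec (xKet 1) (star (xKet 1)) + Matrix.vecMulVec (xKet (-1)) (star (xKet (-1))) =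
      1 := by
  have hhalf := one_div_sqrt_two_mul_self
  ext i j
  simp only [Matrix.add_apply, Matrix.vecMulVec_apply, Pi.star_apply, xKet, Matrix.one_apply]
  fin_cases i <;> fin_cases j <;> simp at hhalf ⊢ <;> linear_combination 2 * hhalf

theorem xProj_sum_eq_one :
    xProj 1 1 + xProj (-1) 1 + (xProj 1 (-1) + xProj (-1) (-1)) = 1 := by
  simp only [xProj_eq_kronecker]
  rw [← Matrix.add_kronecker, ← Matrix.add_kronecker, ← Matrix.kronecker_add,
    vecMulVec_xKet_one_add_neg_one, Matrix.one_kronecker_one]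

theorem phaseError_div_prPhoton {μ : ℝ} (hμ : 0 < μ) (τ : ℝ) {N : Op →ₗ[ℂ] Op}
    (hN : IsKPositive 2 N) (m n : ℕ) :
    ((gain μ τ N m n * phaseErrorRate μ τ N m n / prPhoton μ m : ℝ) : ℂ) = (1 / 2 : ℂ) *
      (opTrace (N (ketBra (psiPM m 1) (psiPM m 1)) ∘L photonBlock n (compOp τ (-1))) +
        opTrace (N (ketBra (psiPM m (-1)) (psiPM m (-1))) ∘L photonBlock n (compOp τ 1))) := by
  have hpr : (prPhoton μ m : ℂ) ≠ 0 := by exact_mod_cast (prPhoton_pos hμ m).ne'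
  rw [Complex.ofReal_div, ofReal_gain_mul_phaseErrorRate hμ.le τ hN, Matrix.mul_add,
    Matrix.trace_add, trace_taggedState_mul_xProj hμ.le, trace_taggedState_mul_xProj hμ.le,
    ← mul_add, mul_div_cancel_left₀ _ hpr, ← mul_add]

theorem ketBra_psiPM_add_ketBra_psiPM_neg (m : ℕ) :
    ketBra (psiPM m 1) (psiPM m 1) + ketBra (psiPM m (-1)) (psiPM m (-1)) =
      (2 : ℂ) • reducedPsi m := by
  simp only [psiPM_eq, reducedPsi, Fin.sum_univ_two, ketBra, map_add, map_smul,
    ContinuousLinearMap.map_smulₛₗ, add_apply, smul_apply, Complex.conj_ofReal]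
  push_cast
  module

theorem gain_div_prPhoton {μ : ℝ} (hμ : 0 < μ) (τ : ℝ) {N : Op →ₗ[ℂ] Op}
    (hN : IsKPositive 2 N) (m n : ℕ) :
    ((gain μ τ N m n / prPhoton μ m : ℝ) : ℂ) = opTrace
      (N (reducedPsi m) ∘L (photonBlock n (compOp τ 1) + photonBlock n (compOp τ (-1)))) := by
  have hpr : (prPhoton μ m : ℂ) ≠ 0 := by exact_mod_cast (prPhoton_pos hμ m).ne'
  have hsum (t : ℝ) :
      opTrace (N (ketBra (psiPM m 1) (psiPM m 1)) ∘L photonBlock n (compOp τ t)) +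
          opTrace (N (ketBra (psiPM m (-1)) (psiPM m (-1))) ∘L photonBlock n (compOp τ t)) =
        2 * opTrace (N (reducedPsi m) ∘L photonBlock n (compOp τ t)) := by
    rw [← opTrace_add (hasFockTrace_comp_photonBlock ..) (hasFockTrace_comp_photonBlock ..),
      ← ContinuousLinearMap.add_comp, ← map_add, ketBra_psiPM_add_ketBra_psiPM_neg, map_smul,
      ContinuousLinearMap.smul_comp, opTrace_smul]
  rw [Complex.ofReal_div, ofReal_gain hμ.le τ hN, ← mul_one (taggedState μ τ N m n),
    ← xProj_sum_eq_one, div_eq_iff hpr, ContinuousLinearMap.comp_add,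
    opTrace_add (hasFockTrace_comp_photonBlock ..) (hasFockTrace_comp_photonBlock ..)]
  simp only [Matrix.mul_add, Matrix.trace_add, trace_taggedState_mul_xProj hμ.le]
  linear_combination (1 / 2 : ℂ) * prPhoton μ m * (hsum 1 + hsum (-1))

/-! ### One and two photons -/

theorem sum_antidiagonal_one {M : Type*} [AddCommMonoid M] (f : ℕ × ℕ → M) :
    ∑ a ∈ antidiagonal 1, f a = f (0, 1) + f (1, 0) := by
  simp [Finset.Nat.sum_antidiagonal_succ]

theorem sum_antidiagonal_two {M : Type*} [AddCommMonoid M] (f : ℕ × ℕ → M) :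
    ∑ a ∈ antidiagonal 2, f a = f (0, 2) + (f (1, 1) + f (2, 0)) := by
  simp [Finset.Nat.sum_antidiagonal_succ]

theorem ketBra_psiPM_one (m : ℕ) :
    ketBra (psiPM m 1) (psiPM m 1) =
      (1 / 2 : ℂ) • ketBra (fock 0 m + fock m 0) (fock 0 m + fock m 0) := by
  rw [psiPM, ketBra_smul_smul, star_one_div_sqrt_two, one_div_sqrt_two_mul_self,
    Complex.ofReal_one, one_smul]

theorem ketBra_psiPM_neg_one (m : ℕ) :
    ketBra (psiPM m (-1)) (psiPM m (-1)) =
      (1 / 2 : ℂ) • ketBra (fock 0 m - fock m 0) (fock 0 m - fock m 0) := by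
  rw [psiPM, ketBra_smul_smul, star_one_div_sqrt_two, one_div_sqrt_two_mul_self,
    Complex.ofReal_neg, Complex.ofReal_one, neg_one_smul, sub_eq_add_neg]

theorem ketBra_psiPM (m : ℕ) (s : ℝ) :
    ketBra (psiPM m s) (psiPM m s) = (1 / 2 : ℂ) •
      (ketBra (fock 0 m) (fock 0 m) + (s : ℂ) • ketBra (fock 0 m) (fock m 0) +
        (s : ℂ) • ketBra (fock m 0) (fock 0 m) + (s : ℂ) ^ 2 • ketBra (fock m 0) (fock m 0)) := by
  rw [psiPM, ketBra_smul_smul, star_one_div_sqrt_two, one_div_sqrt_two_mul_self]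
  simp only [ketBra, map_add, map_smul, ContinuousLinearMap.map_smulₛₗ, add_apply, smul_apply,
    Complex.conj_ofReal]
  module

theorem photonBlock_one_compOp (τ : ℝ) {s : ℝ} (hs : s ^ 2 = 1) :
    photonBlock 1 (compOp τ s) = (cOne τ : ℂ) • ketBra (psiPM 1 s) (psiPM 1 s) := by
  have hs' : (s : ℂ) ^ 2 = 1 := by exact_mod_cast hs
  have h01 : innerOverlap τ 0 1 = 0 := innerOverlap_eq_zero_of_odd τ (by decide)
  have h10 : innerOverlap τ 1 0 = 0 := innerOverlap_eq_zero_of_odd τ (by decide)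
  simp only [photonBlock, sum_antidiagonal_one, compOp_apply, h01, h10, ketBra_psiPM, hs', cOne_eq]
  push_cast
  module

theorem photonBlock_two_compOp (τ : ℝ) {s : ℝ} (hs : s ^ 2 = 1) :
    photonBlock 2 (compOp τ s) =
      (cTwo02 τ + s * dTwo τ : ℂ) • ketBra (psiPM 2 s) (psiPM 2 s) +
        ((1 + s) / 2 * cTwo11 τ : ℂ) • ketBra (fock 1 1) (fock 1 1) := by
  have hs' : (s : ℂ) ^ 2 = 1 := by exact_mod_cast hs
  have h01 : innerOverlap τ 0 1 = 0 := innerOverlap_eq_zero_of_odd τ (by decide)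
  have h10 : innerOverlap τ 1 0 = 0 := innerOverlap_eq_zero_of_odd τ (by decide)
  have h12 : innerOverlap τ 1 2 = 0 := innerOverlap_eq_zero_of_odd τ (by decide)
  have h21 : innerOverlap τ 2 1 = 0 := innerOverlap_eq_zero_of_odd τ (by decide)
  simp only [photonBlock, sum_antidiagonal_two, compOp_apply, h01, h10, h12, h21, ketBra_psiPM,
    hs', cTwo02_eq, cTwo11_eq, dTwo_eq, innerOverlap_comm τ 2 0, outerOverlap_comm τ 2 0]
  obtain rfl | rfl := sq_eq_one_iff.1 hs <;> push_cast <;> module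

theorem photonBlock_one_compOp_add (τ : ℝ) :
    photonBlock 1 (compOp τ 1) + photonBlock 1 (compOp τ (-1)) =
      (cOne τ : ℂ) • (ketBra (fock 0 1) (fock 0 1) + ketBra (fock 1 0) (fock 1 0)) := by
  simp only [photonBlock_one_compOp τ (one_pow 2), photonBlock_one_compOp τ (neg_one_sq),
    ketBra_psiPM]
  push_cast
  module

theorem photonBlock_two_compOp_add (τ : ℝ) :
    photonBlock 2 (compOp τ 1) + photonBlock 2 (compOp τ (-1)) =
      (cTwo02 τ : ℂ) • (ketBra (fock 0 2) (fock 0 2) + ketBra (fock 2 0) (fock 2 0)) +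
        (cTwo11 τ : ℂ) • ketBra (fock 1 1) (fock 1 1) +
        (dTwo τ : ℂ) • (ketBra (fock 0 2) (fock 2 0) + ketBra (fock 2 0) (fock 0 2)) := by
  simp only [photonBlock_two_compOp τ (one_pow 2), photonBlock_two_compOp τ (neg_one_sq),
    ketBra_psiPM]
  push_cast
  module

theorem opTrace_comp_photonBlock_one_compOp (X : Op) (τ : ℝ) {s : ℝ} (hs : s ^ 2 = 1) :
    opTrace (X ∘L photonBlock 1 (compOp τ s)) =
      cOne τ * opTrace (X ∘L ketBra (psiPM 1 s) (psiPM 1 s)) := by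
  rw [photonBlock_one_compOp τ hs, ContinuousLinearMap.comp_smul, opTrace_smul]

theorem opTrace_comp_photonBlock_two_compOp (X : Op) (τ : ℝ) {s : ℝ} (hs : s ^ 2 = 1) :
    opTrace (X ∘L photonBlock 2 (compOp τ s)) =
      (cTwo02 τ + s * dTwo τ) * opTrace (X ∘L ketBra (psiPM 2 s) (psiPM 2 s)) +
        (1 + s) / 2 * cTwo11 τ * opTrace (X ∘L ketBra (fock 1 1) (fock 1 1)) := by
  rw [photonBlock_two_compOp τ hs, ContinuousLinearMap.comp_add, ContinuousLinearMap.comp_smul,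
    ContinuousLinearMap.comp_smul, opTrace_add ((hasFockTrace_comp_ketBra ..).smul _)
    ((hasFockTrace_comp_ketBra ..).smul _), opTrace_smul, opTrace_smul]

theorem opTrace_comp_photonBlock_two_compOp_add (X : Op) (τ : ℝ) :
    opTrace (X ∘L (photonBlock 2 (compOp τ 1) + photonBlock 2 (compOp τ (-1)))) =
      cTwo02 τ * opTrace
          (X ∘L (ketBra (fock 0 2) (fock 0 2) + ketBra (fock 2 0) (fock 2 0))) +
        cTwo11 τ * opTrace (X ∘L ketBra (fock 1 1) (fock 1 1)) +
        dTwo τ * opTrace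
          (X ∘L (ketBra (fock 0 2) (fock 2 0) + ketBra (fock 2 0) (fock 0 2))) := by
  have htrace (x y : TwoMode) : HasFockTrace (X ∘L ketBra x y) := hasFockTrace_comp_ketBra X x y
  simp only [photonBlock_two_compOp_add, ContinuousLinearMap.comp_add,
    ContinuousLinearMap.comp_smul]
  rw [opTrace_add ((((htrace _ _).add (htrace _ _)).smul _).add ((htrace _ _).smul _))
      (((htrace _ _).add (htrace _ _)).smul _),
    opTrace_add (((htrace _ _).add (htrace _ _)).smul _) ((htrace _ _).smul _), opTrace_smul,
    opTrace_smul, opTrace_smul]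

end

end TimeBinCV

open TimeBinCV in
theorem mainTheorem3_general (μ τ : ℝ) (hμ : 0 < μ) (N : Op →ₗ[ℂ] Op) (hN : IsKPositive 2 N) :
    (∀ m n : ℕ,
      ((gain μ τ N m n * phaseErrorRate μ τ N m n / prPhoton μ m : ℝ) : ℂ) =
        (1 / 2 : ℂ) * opTrace
          (N (ketBra (psiPM m 1) (psiPM m 1)) ∘L photonBlock n (compOp τ (-1)) +
            N (ketBra (psiPM m (-1)) (psiPM m (-1))) ∘L photonBlock n (compOp τ 1))) ∧
    (((gain μ τ N 1 1 * phaseErrorRate μ τ N 1 1 / prPhoton μ 1 : ℝ) : ℂ) =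
      (cOne τ / 2 : ℂ) *
        (opTrace (N (ketBra (psiPM 1 1) (psiPM 1 1)) ∘L
            ((1 / 2 : ℂ) • ketBra (fock 0 1 - fock 1 0) (fock 0 1 - fock 1 0))) +
          opTrace (N (ketBra (psiPM 1 (-1)) (psiPM 1 (-1))) ∘L
            ((1 / 2 : ℂ) • ketBra (fock 0 1 + fock 1 0) (fock 0 1 + fock 1 0))))) ∧
    (((gain μ τ N 1 1 / prPhoton μ 1 : ℝ) : ℂ) =
      (cOne τ : ℂ) * opTrace (N (reducedPsi 1) ∘L
        (ketBra (fock 0 1) (fock 0 1) + ketBra (fock 1 0) (fock 1 0)))) ∧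
    (((gain μ τ N 2 2 * phaseErrorRate μ τ N 2 2 / prPhoton μ 2 : ℝ) : ℂ) =
      (1 / 2 : ℂ) * (cTwo02 τ - dTwo τ) *
          opTrace (N (ketBra (psiPM 2 1) (psiPM 2 1)) ∘L
            ((1 / 2 : ℂ) • ketBra (fock 0 2 - fock 2 0) (fock 0 2 - fock 2 0))) +
        (1 / 2 : ℂ) * (cTwo02 τ + dTwo τ) *
          opTrace (N (ketBra (psiPM 2 (-1)) (psiPM 2 (-1))) ∘L
            ((1 / 2 : ℂ) • ketBra (fock 0 2 + fock 2 0) (fock 0 2 + fock 2 0))) +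
        (1 / 2 : ℂ) * cTwo11 τ *
          opTrace (N (ketBra (psiPM 2 (-1)) (psiPM 2 (-1))) ∘L
            ketBra (fock 1 1) (fock 1 1))) ∧
    (((gain μ τ N 2 2 / prPhoton μ 2 : ℝ) : ℂ) =
      (cTwo02 τ : ℂ) * opTrace (N (reducedPsi 2) ∘L
          (ketBra (fock 0 2) (fock 0 2) + ketBra (fock 2 0) (fock 2 0))) +
        (cTwo11 τ : ℂ) * opTrace (N (reducedPsi 2) ∘L ketBra (fock 1 1) (fock 1 1)) +
        (dTwo τ : ℂ) * opTrace (N (reducedPsi 2) ∘L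
          (ketBra (fock 0 2) (fock 2 0) + ketBra (fock 2 0) (fock 0 2)))) := by
  refine ⟨fun m n => ?_, ?_, ?_, ?_, ?_⟩
  · rw [opTrace_add (hasFockTrace_comp_photonBlock ..) (hasFockTrace_comp_photonBlock ..),
      phaseError_div_prPhoton hμ τ hN]
  · rw [phaseError_div_prPhoton hμ τ hN, opTrace_comp_photonBlock_one_compOp _ τ neg_one_sq,
      opTrace_comp_photonBlock_one_compOp _ τ (one_pow 2), ← ketBra_psiPM_one,
      ← ketBra_psiPM_neg_one]
    ring
  · rw [gain_div_prPhoton hμ τ hN, photonBlock_one_compOp_add, ContinuousLinearMap.comp_smul,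
      opTrace_smul]
  · rw [phaseError_div_prPhoton hμ τ hN, opTrace_comp_photonBlock_two_compOp _ τ neg_one_sq,
      opTrace_comp_photonBlock_two_compOp _ τ (one_pow 2), ← ketBra_psiPM_one,
      ← ketBra_psiPM_neg_one]
    push_cast
    ring
  · rw [gain_div_prPhoton hμ τ hN, opTrace_comp_photonBlock_two_compOp_add]

open TimeBinCV in
theorem mainTheorem3 (μ τ : ℝ) (hμ : 0 < μ) (N : Op →ₗ[ℂ] Op) (hN : IsChannel N) :
    (∀ m n : ℕ,
      ((gain μ τ N m n * phaseErrorRate μ τ N m n / prPhoton μ m : ℝ) : ℂ) =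
        (1 / 2 : ℂ) * opTrace
          (N (ketBra (psiPM m 1) (psiPM m 1)) ∘L photonBlock n (compOp τ (-1)) +
            N (ketBra (psiPM m (-1)) (psiPM m (-1))) ∘L photonBlock n (compOp τ 1))) ∧
    (((gain μ τ N 1 1 * phaseErrorRate μ τ N 1 1 / prPhoton μ 1 : ℝ) : ℂ) =
      (cOne τ / 2 : ℂ) *
        (opTrace (N (ketBra (psiPM 1 1) (psiPM 1 1)) ∘L
            ((1 / 2 : ℂ) • ketBra (fock 0 1 - fock 1 0) (fock 0 1 - fock 1 0))) +
          opTrace (N (ketBra (psiPM 1 (-1)) (psiPM 1 (-1))) ∘L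
            ((1 / 2 : ℂ) • ketBra (fock 0 1 + fock 1 0) (fock 0 1 + fock 1 0))))) ∧
    (((gain μ τ N 1 1 / prPhoton μ 1 : ℝ) : ℂ) =
      (cOne τ : ℂ) * opTrace (N (reducedPsi 1) ∘L
        (ketBra (fock 0 1) (fock 0 1) + ketBra (fock 1 0) (fock 1 0)))) ∧
    (((gain μ τ N 2 2 * phaseErrorRate μ τ N 2 2 / prPhoton μ 2 : ℝ) : ℂ) =
      (1 / 2 : ℂ) * (cTwo02 τ - dTwo τ) *
          opTrace (N (ketBra (psiPM 2 1) (psiPM 2 1)) ∘L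
            ((1 / 2 : ℂ) • ketBra (fock 0 2 - fock 2 0) (fock 0 2 - fock 2 0))) +
        (1 / 2 : ℂ) * (cTwo02 τ + dTwo τ) *
          opTrace (N (ketBra (psiPM 2 (-1)) (psiPM 2 (-1))) ∘L
            ((1 / 2 : ℂ) • ketBra (fock 0 2 + fock 2 0) (fock 0 2 + fock 2 0))) +
        (1 / 2 : ℂ) * cTwo11 τ *
          opTrace (N (ketBra (psiPM 2 (-1)) (psiPM 2 (-1))) ∘L
            ketBra (fock 1 1) (fock 1 1))) ∧
    (((gain μ τ N 2 2 / prPhoton μ 2 : ℝ) : ℂ) =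
      (cTwo02 τ : ℂ) * opTrace (N (reducedPsi 2) ∘L
          (ketBra (fock 0 2) (fock 0 2) + ketBra (fock 2 0) (fock 2 0))) +
        (cTwo11 τ : ℂ) * opTrace (N (reducedPsi 2) ∘L ketBra (fock 1 1) (fock 1 1)) +
        (dTwo τ : ℂ) * opTrace (N (reducedPsi 2) ∘L
          (ketBra (fock 0 2) (fock 2 0) + ketBra (fock 2 0) (fock 0 2)))) := by
  exact mainTheorem3_general μ τ hμ N (hN.completelyPositive 2)
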